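/- Let $(\Omega,\mathcal F,\mathbb P)$ be a probability space carrying a standard Brownian motion $B$, a Poisson process $N$ with intensity $\lambda>0$, and i.i.d. nonnegative claims $Y_1,Y_2,\dots$ independent of $N$. Let $c,M,a,\hat b,\hat\sigma>0$ be constants. For $r\in\mathbb R$ let $(r_t)_{t\ge0}$ be the Ornstein–Uhlenbeck process $$dr_t=a(\hat b-r_t)\,dt+\hat\sigma\,dB_t,\qquad r_0=r .$$ For $x\ge 0$ let $X_t=x+ct-\sum_{k=1}^{N(t)}Y_k$, and let $(\mathcal F_t)$ be the filtration generated by $(B,X)$. An admissible strategy is a process $L_t=\int_0^t l_s\,ds$ with $l_s\in[0,M]$ that is $(\mathcal F_t)$-predictable, nondecreasing and càdlàg and is such that the surplus $X^L_t=X_t-L_t$ is nonnegative for all $t<\tau^L$, where $\tau^L=\inf\{t\ge0: X^L_t<0\}$ (with $\inf\emptyset=\infty$) is the ruin time. Let $$V(r,x)=\sup_{L\text{ admissible}}\mathbb E\left[\int_0^{\tau^L}e^{-\int_0^s r_u\,du}\,l_s\,ds\right].$$ Put $b=\hat b-\dfrac{\hat\sigma^2}{2a^2}$ and assume $b>0$.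 Then for all $r\in\mathbb R$ and $x\ge0$, $$V(r,x)\le \frac{M}{b}\,e^{-\min\left\{\frac{r-b}{a},\,0\right\}}.$$ In particular $V$ is finite, and it is bounded on $[r_0,\infty)\times[0,\infty)$ for every $r_0\in\mathbb R$. -/

import Mathlib

open MeasureTheory ProbabilityTheory Filter Topology
open scoped NNReal ENNReal

noncomputable section

namespace VasicekDividend

/-- `N` is a Poisson process with intensity `lam`: it starts at `0`, its paths are nondecreasing and
right-continuous, its increments are independent, and `N (s + t) - N s` is Poisson distributed with
parameter `lam * t`. (Increments are taken in `ℝ`.) -/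
structure IsPoissonProcess {Ω : Type*} [MeasurableSpace Ω] (N : ℝ≥0 → Ω → ℕ) (lam : ℝ≥0)
    (P : Measure Ω) : Prop where
  measurable : ∀ t, Measurable (N t)
  start : ∀ᵐ ω ∂P, N 0 ω = 0
  mono : ∀ᵐ ω ∂P, Monotone (fun t => N t ω)
  rightCont : ∀ᵐ ω ∂P, ∀ t, ContinuousWithinAt (fun s => N s ω) (Set.Ici t) t
  indepIncrements : HasIndepIncrements (fun t ω => (N t ω : ℝ)) P
  incrementLaw : ∀ s t, HasLaw (fun ω => (N (s + t) ω : ℝ) - (N s ω : ℝ))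
    ((poissonMeasure (lam * t)).map (Nat.cast : ℕ → ℝ)) P

/-- `ρ` is a solution, with initial value `r`, of the Vasicek (Ornstein-Uhlenbeck) equation
`dρ_t = a (bhat - ρ_t) dt + sigma dB_t`. The noise is additive, so the integrated equation
`ρ_t = r + ∫_0^t a (bhat - ρ_u) du + sigma B_t` involves no further stochastic integral. -/
def IsVasicekSolution {Ω : Type*} [MeasurableSpace Ω] (P : Measure Ω) (B : ℝ≥0 → Ω → ℝ)
    (a bhat sigma r : ℝ) (ρ : ℝ≥0 → Ω → ℝ) : Prop :=
  ∀ᵐ ω ∂P, Continuous (fun t => ρ t ω) ∧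
    ∀ t : ℝ≥0, ρ t ω = r + (∫ u in (0 : ℝ)..t, a * (bhat - ρ u.toNNReal ω)) + sigma * B t ω

/-- The data of the dividend problem with Vasicek interest rate on a probability space `(Ω, P)`. -/
structure Model (Ω : Type*) [MeasurableSpace Ω] (P : Measure Ω) where
  /-- premium rate -/
  c : ℝ
  c_pos : 0 < c
  /-- maximal dividend rate -/
  M : ℝ
  M_pos : 0 < M
  /-- claim intensity -/
  lam : ℝ≥0
  lam_pos : 0 < lam
  /-- distribution of the claim sizes -/
  G : Measure ℝ
  G_nonneg : ∀ᵐ y ∂G, 0 ≤ y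
  /-- claim number process -/
  N : ℝ≥0 → Ω → ℕ
  poisson : IsPoissonProcess N lam P
  /-- claim sizes; `Y k` is the size of the `(k + 1)`-st claim -/
  Y : ℕ → Ω → ℝ
  Y_measurable : ∀ k, Measurable (Y k)
  Y_indep : iIndepFun Y P
  Y_law : ∀ k, HasLaw (Y k) G P
  N_indep_Y : IndepFun (fun ω t => N t ω) (fun ω k => Y k ω) P
  /-- the standard Brownian motion driving the interest rate -/
  B : ℝ≥0 → Ω → ℝ
  B_measurable : ∀ t, Measurable (B t)
  brownian : IsBrownianReal B P
  /-- speed of mean reversion -/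
  a : ℝ
  a_pos : 0 < a
  /-- long-term mean of the interest rate -/
  bhat : ℝ
  bhat_pos : 0 < bhat
  /-- volatility of the interest rate -/
  sigma : ℝ
  sigma_pos : 0 < sigma
  /-- `rate r` is the interest rate process with initial value `r` -/
  rate : ℝ → ℝ≥0 → Ω → ℝ
  rate_sde : ∀ r, IsVasicekSolution P B a bhat sigma r (rate r)

variable {Ω : Type*} [mΩ : MeasurableSpace Ω] {P : Measure Ω}

namespace Model

/-- The reserve process without dividends, `X_t = x + c t - ∑_{k = 1}^{N(t)} Y_k`. -/
def reserve (m : Model Ω P) (x : ℝ) (t : ℝ≥0) (ω : Ω) : ℝ :=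
  x + m.c * t - ∑ k ∈ Finset.range (m.N t ω), m.Y k ω

theorem measurable_reserve (m : Model Ω P) (x : ℝ) (t : ℝ≥0) : Measurable (m.reserve x t) := by
  have h : Measurable (fun p : ℕ × Ω => ∑ k ∈ Finset.range p.1, m.Y k p.2) :=
    measurable_from_prod_countable_right fun n =>
      Finset.measurable_fun_sum (Finset.range n) fun k _ => m.Y_measurable k
  exact measurable_const.sub (h.comp ((m.poisson.measurable t).prodMk measurable_id))

/-- The filtration generated by the pair `(B, X)`. -/
def filtration (m : Model Ω P) (x : ℝ) : Filtration ℝ≥0 mΩ :=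
  Filtration.natural (fun t ω => (m.B t ω, m.reserve x t ω)) fun t =>
    ((m.B_measurable t).prodMk (m.measurable_reserve x t)).stronglyMeasurable

end Model

/-- The cumulated dividends `L_t = ∫_0^t l_s ds` of the dividend rate process `l`. -/
def cumulated (l : ℝ≥0 → Ω → ℝ) (t : ℝ≥0) (ω : Ω) : ℝ :=
  ∫ s in (0 : ℝ)..t, l s.toNNReal ω

namespace Model

/-- The surplus process `X_t^L = X_t - L_t` when dividends are paid at rate `l`. -/
def surplus (m : Model Ω P) (x : ℝ) (l : ℝ≥0 → Ω → ℝ) (t : ℝ≥0) (ω : Ω) : ℝ :=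
  m.reserve x t ω - cumulated l t ω

/-- The ruin time `inf {t ≥ 0 | X_t^L < 0}`, which is `⊤` if there is no ruin. -/
def ruinTime (m : Model Ω P) (x : ℝ) (l : ℝ≥0 → Ω → ℝ) : Ω → WithTop ℝ≥0 :=
  hittingAfter (m.surplus x l) (Set.Iio 0) 0

/-- The strategy of paying dividends at the rate `l` is admissible for the initial surplus `x`:
the rate takes values in `[0, M]`, the cumulated dividends are predictable, nondecreasing and
cadlag, and the surplus is nonnegative up to the time of ruin. -/
structure Admissible (m : Model Ω P) (x : ℝ) (l : ℝ≥0 → Ω → ℝ) : Prop where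
  measurable : Measurable (Function.uncurry l)
  mem_Icc : ∀ t ω, l t ω ∈ Set.Icc 0 m.M
  predictable : IsStronglyPredictable (m.filtration x) (cumulated l)
  mono : ∀ ω, Monotone (fun t => cumulated l t ω)
  cadlag : ∀ ω t, ContinuousWithinAt (fun s => cumulated l s ω) (Set.Ici t) t ∧
    ∃ y, Tendsto (fun s => cumulated l s ω) (𝓝[<] t) (𝓝 y)
  nonneg : ∀ (ω : Ω) (t : ℝ≥0), (t : WithTop ℝ≥0) < m.ruinTime x l ω → 0 ≤ m.surplus x l t ω

/-- The integrated interest rate `U_s^r = ∫_0^s r_u du` with initial rate `r`. -/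
def integratedRate (m : Model Ω P) (r s : ℝ) (ω : Ω) : ℝ :=
  ∫ u in (0 : ℝ)..s, m.rate r u.toNNReal ω

/-- The return function `V^L(r, x) = E[∫_0^{τ^L} exp(-U_s^r) l_s ds]` of the strategy with dividend
rate `l`. The integrand is nonnegative, and the value lies in `[0, ∞]`. -/
def returnFunction (m : Model Ω P) (l : ℝ≥0 → Ω → ℝ) (r x : ℝ) : ℝ≥0∞ :=
  ∫⁻ ω, (∫⁻ s in {s : ℝ | 0 ≤ s ∧ ((s.toNNReal : ℝ≥0) : WithTop ℝ≥0) < m.ruinTime x l ω},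
    ENNReal.ofReal (Real.exp (-m.integratedRate r s ω) * l s.toNNReal ω)) ∂P

/-- The value function: the supremum of the return function over all admissible strategies. It is
`[0, ∞]`-valued a priori. -/
def value (m : Model Ω P) (r x : ℝ) : ℝ≥0∞ :=
  ⨆ (l : ℝ≥0 → Ω → ℝ) (_ : m.Admissible x l), m.returnFunction l r x

end Model

end VasicekDividend

end

namespace VasicekDividend

/-! Since `l ≤ M`, discarding ruin leaves `M` times the expected integral of `exp (-U_s)` over `s ≥
0`, and Tonelli reduces this to `E[exp (-U_s)]` for fixed `s`. Variation of constants
(`integral_eq_of_vasicek`) splits `U_s` into a deterministic part and `σ` times the Wiener integral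
of `g u = (1 - exp (-a (s - u))) / a`, written pathwise after integration by parts. Riemann sums of
this integral have explicit exponential moments by independence of Gaussian increments, and Fatou
passes the bound to the limit (`lintegral_exp_neg_integral_le`); an upper bound is all that is
needed. With `e = exp (-a s)` the resulting exponent is `-b s - (r - b)/a * (1 - e) - σ²/(4 a³) * (1
- e)²`, hence at most `-b s - min ((r - b)/a) 0` (`discount_exponent_le`). Integrating `exp (-b s)`
produces the factor `1 / b`. -/

/-! ### Pathwise calculus -/

/-- Variation of constants for the integral of a solution of the Vasicek equation driven by `w`. -/
theorem integral_eq_of_vasicek {a β σ r : ℝ} (ha : a ≠ 0) {ρ w : ℝ → ℝ} (hρ : Continuous ρ)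
    (hw : Continuous w) {s : ℝ} (hs : 0 ≤ s)
    (h : ∀ t, 0 ≤ t → ρ t = r + (∫ u in (0 : ℝ)..t, a * (β - ρ u)) + σ * w t) :
    ∫ u in (0 : ℝ)..s, ρ u = β * s + (r - β) * (1 - Real.exp (-(a * s))) / a
      + σ * ∫ u in (0 : ℝ)..s, w u * Real.exp (-(a * (s - u))) := by
  have hcw : Continuous fun u => w u * Real.exp (a * u) := by fun_prop
  -- The difference of the two sides times `exp (a t)`: the factor removes `t` from under the
  -- integral sign, and the equation makes the derivative vanish.
  let D : ℝ → ℝ := fun t => Real.exp (a * t) * ((∫ u in (0 : ℝ)..t, ρ u) - β * t)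
    - (r - β) * (Real.exp (a * t) - 1) / a - σ * ∫ u in (0 : ℝ)..t, w u * Real.exp (a * u)
  have hD : ∀ t ∈ Set.uIcc 0 s, HasDerivAt D 0 t := by
    intro t ht
    rw [Set.uIcc_of_le hs] at ht
    have hE : HasDerivAt (fun t => Real.exp (a * t)) (Real.exp (a * t) * a) t := by
      simpa using ((hasDerivAt_id t).const_mul a).exp
    have hR := hρ.integral_hasStrictDerivAt 0 t |>.hasDerivAt
    have hW := hcw.integral_hasStrictDerivAt 0 t |>.hasDerivAt
    have key := ((hE.mul (hR.sub ((hasDerivAt_id t).const_mul β))).sub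
      (((hE.sub_const 1).const_mul (r - β)).div_const a)).sub (hW.const_mul σ)
    refine key.congr_deriv ?_
    have e1 : (∫ u in (0 : ℝ)..t, a * (β - ρ u)) = a * (β * t - ∫ u in (0 : ℝ)..t, ρ u) := by
      rw [intervalIntegral.integral_const_mul, intervalIntegral.integral_sub
        (by simp) (hρ.intervalIntegrable 0 t)]
      simp [mul_comm]
    have h1 := h t ht.1
    rw [e1] at h1
    simp only [Pi.sub_apply, id_eq]
    rw [h1]
    field_simp
    ring
  have h0 : D s - D 0 = 0 := by
    have := intervalIntegral.integral_eq_sub_of_hasDerivAt hD (by simp)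
    simpa using this.symm
  have e2 : (∫ u in (0 : ℝ)..s, w u * Real.exp (-(a * (s - u))))
      = Real.exp (-(a * s)) * ∫ u in (0 : ℝ)..s, w u * Real.exp (a * u) := by
    rw [← intervalIntegral.integral_const_mul]
    congr 1 with u
    rw [mul_left_comm, ← Real.exp_add]
    ring_nf
  have hD0 : D 0 = 0 := by simp [D]
  rw [hD0, sub_zero] at h0
  simp only [D] at h0
  have hee : Real.exp (-(a * s)) * Real.exp (a * s) = 1 := by
    rw [← Real.exp_add]; simp
  rw [e2]
  set I := ∫ u in (0 : ℝ)..s, w u * Real.exp (a * u)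
  set R := ∫ u in (0 : ℝ)..s, ρ u
  set e := Real.exp (-(a * s))
  set f := Real.exp (a * s)
  have h2 : e * f * (R - β * s) - (r - β) * (e * f - e) / a - σ * (e * I) = 0 := by
    linear_combination e * h0
  rw [hee] at h2
  linear_combination h2

/-- Riemann-Stieltjes sums of `∫ g dw` converge to the integral obtained by integrating by parts. -/
theorem tendsto_sum_mul_sub {w g g' : ℝ → ℝ} (hw : Continuous w) (hw0 : w 0 = 0)
    (hg : ∀ u, HasDerivAt g (g' u) u) (hg' : Continuous g') {s : ℝ} (hs : 0 ≤ s) (hgs : g s = 0) :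
    Tendsto (fun n : ℕ => ∑ i ∈ Finset.range (n + 1), g ((i + 1 : ℕ) * (s / (n + 1 : ℕ)))
      * (w ((i + 1 : ℕ) * (s / (n + 1 : ℕ))) - w (i * (s / (n + 1 : ℕ))))) atTop
      (𝓝 (-∫ u in (0 : ℝ)..s, w u * g' u)) := by
  obtain ⟨K, hK⟩ := (isCompact_Icc (a := 0) (b := s)).exists_bound_of_continuousOn hg'.continuousOn
  have hK0 : 0 ≤ K := (norm_nonneg _).trans (hK 0 ⟨le_rfl, hs⟩)
  have huc := (isCompact_Icc (a := 0) (b := s)).uniformContinuousOn_of_continuous hw.continuousOn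
  rw [Metric.uniformContinuousOn_iff_le] at huc
  rw [Metric.tendsto_atTop']
  intro ε hε
  -- The accumulated error will be at most this oscillation times `K * s`; the `+ 1` covers `K * s =
  -- 0`.
  obtain ⟨δ, hδ, hwδ⟩ := huc (ε / (2 * (K * s + 1))) (by positivity)
  obtain ⟨n₀, hn₀⟩ := exists_nat_gt (s / δ)
  refine ⟨n₀, fun n hn => ?_⟩
  set η := s / (n + 1 : ℕ) with hη
  have hη0 : 0 ≤ η := by positivity
  have hηδ : η ≤ δ := by
    rw [hη, div_le_iff₀ (by positivity)]
    rw [div_lt_iff₀ hδ] at hn₀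
    have : (n₀ : ℝ) ≤ (n + 1 : ℕ) := by exact_mod_cast (by omega)
    nlinarith
  have hηs : ((n + 1 : ℕ) : ℝ) * η = s := by rw [hη]; field_simp
  have hgi : ∀ x y, IntervalIntegrable g' volume x y := fun x y => hg'.intervalIntegrable x y
  have hwgi : ∀ x y, IntervalIntegrable (fun u => w u * g' u) volume x y :=
    fun x y => (hw.mul hg').intervalIntegrable x y
  -- Summation by parts, with increments of `g` written as integrals of `g'`. The boundary terms
  -- vanish because `w 0 = 0` and, at `m = n + 1`, `g s = 0`.
  have abel : ∀ m : ℕ, ∑ i ∈ Finset.range m, g ((i + 1 : ℕ) * η)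
      * (w ((i + 1 : ℕ) * η) - w (i * η)) = g (m * η) * w (m * η)
      - ∑ i ∈ Finset.range m, ∫ u in (i * η : ℝ)..((i + 1 : ℕ) * η), w (i * η) * g' u := by
    intro m
    induction m with
    | zero => simp [hw0]
    | succ m ih =>
      rw [Finset.sum_range_succ, Finset.sum_range_succ, ih,
        intervalIntegral.integral_const_mul,
        intervalIntegral.integral_eq_sub_of_hasDerivAt (fun x _ => hg x) (hgi _ _)]
      ring
  have hsplit : ∫ u in (0 : ℝ)..s, w u * g' u
      = ∑ i ∈ Finset.range (n + 1), ∫ u in (i * η : ℝ)..((i + 1 : ℕ) * η), w u * g' u := by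
    rw [intervalIntegral.sum_integral_adjacent_intervals (a := fun i : ℕ => (i : ℝ) * η)
      (fun k _ => hwgi _ _), hηs]
    simp
  rw [abel, hηs, hgs, hsplit, zero_mul, zero_sub, Real.dist_eq, neg_sub_neg,
    ← Finset.sum_sub_distrib]
  have hterm : ∀ i ∈ Finset.range (n + 1),
      |(∫ u in (i * η : ℝ)..((i + 1 : ℕ) * η), w u * g' u)
        - ∫ u in (i * η : ℝ)..((i + 1 : ℕ) * η), w (i * η) * g' u|
      ≤ ε / (2 * (K * s + 1)) * K * η := by
    intro i hi
    have hi1 : ((i + 1 : ℕ) : ℝ) * η ≤ s := by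
      rw [← hηs]
      have : ((i + 1 : ℕ) : ℝ) ≤ (n + 1 : ℕ) := by
        exact_mod_cast Finset.mem_range.1 hi
      gcongr
    have hlen : ((i + 1 : ℕ) : ℝ) * η - i * η = η := by push_cast; ring
    rw [← intervalIntegral.integral_sub (hwgi _ _) ((hgi _ _).const_mul _)]
    have := intervalIntegral.norm_integral_le_of_norm_le_const
      (a := (i * η : ℝ)) (b := (i + 1 : ℕ) * η) (f := fun u => w u * g' u - w (i * η) * g' u)
      (C := ε / (2 * (K * s + 1)) * K) (fun u hu => ?_)
    · rwa [hlen, abs_of_nonneg hη0, Real.norm_eq_abs] at this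
    · rw [Set.uIoc_of_le (by linarith)] at hu
      have hi0 : 0 ≤ (i : ℝ) * η := by positivity
      have hu1 : u ∈ Set.Icc 0 s := ⟨by linarith [hu.1], by linarith [hu.2]⟩
      rw [← sub_mul, norm_mul]
      refine mul_le_mul ?_ (hK u hu1) (norm_nonneg _) (by positivity)
      rw [← dist_eq_norm]
      refine hwδ _ hu1 _ ⟨hi0, by linarith⟩ ?_
      rw [Real.dist_eq, abs_of_nonneg (by linarith [hu.1])]
      linarith [hu.2]
  calc _ ≤ ∑ i ∈ Finset.range (n + 1), ε / (2 * (K * s + 1)) * K * η :=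
        (Finset.abs_sum_le_sum_abs _ _).trans (Finset.sum_le_sum hterm)
    _ = ε * ((K * s) / (2 * (K * s + 1))) := by
        rw [Finset.sum_const, Finset.card_range, nsmul_eq_mul, mul_left_comm, hηs]
        ring
    _ < ε := by
        have : 0 ≤ K * s := by positivity
        have : (K * s) / (2 * (K * s + 1)) < 1 := by
          rw [div_lt_one (by positivity)]; linarith
        nlinarith

/-- Right endpoint sums of an antitone function are bounded by its integral. -/
theorem sum_mul_le_integral_of_antitoneOn {f : ℝ → ℝ} (hf : Continuous f) {s : ℝ} (hs : 0 ≤ s)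
    (hanti : AntitoneOn f (Set.Icc 0 s)) (n : ℕ) :
    ∑ i ∈ Finset.range (n + 1), f ((i + 1 : ℕ) * (s / (n + 1 : ℕ))) * (s / (n + 1 : ℕ))
      ≤ ∫ u in (0 : ℝ)..s, f u := by
  set η := s / (n + 1 : ℕ) with hη
  have hη0 : 0 ≤ η := by positivity
  have hηs : ((n + 1 : ℕ) : ℝ) * η = s := by rw [hη]; field_simp
  have hsplit : ∫ u in (0 : ℝ)..s, f u
      = ∑ i ∈ Finset.range (n + 1), ∫ u in (i * η : ℝ)..((i + 1 : ℕ) * η), f u := by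
    rw [intervalIntegral.sum_integral_adjacent_intervals (a := fun i : ℕ => (i : ℝ) * η)
      (fun k _ => hf.intervalIntegrable _ _), hηs]
    simp
  rw [hsplit]
  refine Finset.sum_le_sum fun i hi => ?_
  have hi1 : ((i + 1 : ℕ) : ℝ) * η ≤ s := by
    rw [← hηs]
    have : ((i + 1 : ℕ) : ℝ) ≤ (n + 1 : ℕ) := by
      exact_mod_cast Finset.mem_range.1 hi
    gcongr
  have hlen : ((i + 1 : ℕ) : ℝ) * η - i * η = η := by push_cast; ring
  have hi0 : 0 ≤ (i : ℝ) * η := by positivity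
  calc f ((i + 1 : ℕ) * η) * η
      = ∫ u in (i * η : ℝ)..((i + 1 : ℕ) * η), f ((i + 1 : ℕ) * η) := by
        rw [intervalIntegral.integral_const, hlen, smul_eq_mul, mul_comm]
    _ ≤ _ := by
        refine intervalIntegral.integral_mono_on (by linarith) (by simp)
          (hf.intervalIntegrable _ _) fun u hu => hanti ?_ ?_ hu.2
        · exact ⟨by linarith [hu.1], by linarith [hu.2]⟩
        · exact ⟨by positivity, hi1⟩

/-! ### Gaussian exponential moments -/

/-- Exponential moment of a linear combination of increments of a pre-Brownian motion. -/
theorem lintegral_exp_sum_increments {Ω : Type*} [MeasurableSpace Ω] {P : Measure Ω}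
    {C : ℝ≥0 → Ω → ℝ} (hC : IsPreBrownianReal C P) {t : ℕ → ℝ≥0} (ht : Monotone t) (k : ℕ → ℝ)
    (n : ℕ) :
    ∫⁻ ω, ENNReal.ofReal (Real.exp (∑ i ∈ Finset.range n,
        k i * (C (t (i + 1)) ω - C (t i) ω))) ∂P
      = ENNReal.ofReal (Real.exp (∑ i ∈ Finset.range n,
        k i ^ 2 * ((t (i + 1) : ℝ) - t i) / 2)) := by
  have hP : IsProbabilityMeasure P := hC.isGaussianProcess.isProbabilityMeasure
  let Z : ℕ → Ω → ℝ := fun i ω => k i * (C (t (i + 1)) ω - C (t i) ω)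
  have hZ : iIndepFun Z P :=
    (hC.hasIndepIncrements.nat ht).comp (fun i x => k i * x) fun i => by fun_prop
  have hm : ∀ i, AEMeasurable (Z i) P := fun i =>
    ((hC.aemeasurable _).sub (hC.aemeasurable _)).const_mul _
  have hmgf : mgf (∑ i ∈ Finset.range n, Z i) P 1
      = Real.exp (∑ i ∈ Finset.range n, k i ^ 2 * ((t (i + 1) : ℝ) - t i) / 2) := by
    rw [hZ.mgf_sum₀ hm, Real.exp_sum]
    refine Finset.prod_congr rfl fun i _ => ?_
    have h1 : mgf (Z i) P 1 = mgf (C (t (i + 1)) - C (t i)) P (k i * 1) :=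
      mgf_const_mul _
    rw [h1, mgf_gaussianReal (hC.hasLaw_sub _ _).map_eq]
    congr 1
    have : ((nndist (t (i + 1)).1 (t i).1 : ℝ≥0) : ℝ) = (t (i + 1) : ℝ) - t i := by
      rw [coe_nndist, Real.dist_eq]
      exact abs_of_nonneg (sub_nonneg.2 (NNReal.coe_le_coe.2 (ht i.le_succ)))
    rw [this]
    ring
  -- A non-integrable exponential would have `mgf` equal to the default value `0`, so positivity
  -- gives integrability.
  have hint : Integrable (fun ω => Real.exp (1 * (∑ i ∈ Finset.range n, Z i) ω)) P := by
    rw [← mgf_pos_iff, hmgf]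
    exact Real.exp_pos _
  rw [← hmgf, mgf, ofReal_integral_eq_lintegral_ofReal hint (ae_of_all _ fun _ => (Real.exp_pos _).le)]
  simp [Z]

/-- Up to the factor `σ² / a²`, this is the variance of the integrated rate. -/
theorem integral_one_sub_exp_sq {a : ℝ} (ha : a ≠ 0) (s : ℝ) :
    ∫ u in (0 : ℝ)..s, (1 - Real.exp (-(a * (s - u)))) ^ 2
      = s - 2 * (1 - Real.exp (-(a * s))) / a + (1 - Real.exp (-(a * s)) ^ 2) / (2 * a) := by
  have hE : ∀ u, HasDerivAt (fun u => Real.exp (-(a * (s - u))))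
      (Real.exp (-(a * (s - u))) * a) u := fun u => by
    simpa using (((hasDerivAt_id u).const_sub s).const_mul a).neg.exp
  have hF : ∀ u ∈ Set.uIcc 0 s, HasDerivAt (fun u => u - 2 * Real.exp (-(a * (s - u))) / a
      + Real.exp (-(a * (s - u))) ^ 2 / (2 * a)) ((1 - Real.exp (-(a * (s - u)))) ^ 2) u := by
    intro u _
    refine (((hasDerivAt_id u).sub (((hE u).const_mul 2).div_const a)).add
      (((hE u).pow 2).div_const (2 * a))).congr_deriv ?_
    field_simp
    ring
  rw [intervalIntegral.integral_eq_sub_of_hasDerivAt hF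
    (Continuous.intervalIntegrable (by fun_prop) _ _)]
  simp
  ring

/-- Exponential moments of the stochastic part of the integrated Vasicek process. -/
theorem lintegral_exp_neg_integral_le {Ω : Type*} [MeasurableSpace Ω] {P : Measure Ω}
    {C : ℝ≥0 → Ω → ℝ} (hC : IsPreBrownianReal C P) (hcont : ∀ ω, Continuous fun t => C t ω)
    (hzero : ∀ ω, C 0 ω = 0) {a : ℝ} (ha : 0 < a) (σ : ℝ) {s : ℝ} (hs : 0 ≤ s) :
    ∫⁻ ω, ENNReal.ofReal (Real.exp (-(σ * ∫ u in (0 : ℝ)..s,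
        C u.toNNReal ω * Real.exp (-(a * (s - u)))))) ∂P
      ≤ ENNReal.ofReal (Real.exp (σ ^ 2 / (2 * a ^ 2) * (s - 2 * (1 - Real.exp (-(a * s))) / a
        + (1 - Real.exp (-(a * s)) ^ 2) / (2 * a)))) := by
  -- The primitive of minus the kernel that vanishes at `s`, so integration by parts leaves no
  -- boundary term.
  let g : ℝ → ℝ := fun u => (1 - Real.exp (-(a * (s - u)))) / a
  let t : ℕ → ℕ → ℝ≥0 := fun n i => i * (s.toNNReal / (n + 1 : ℕ))
  have ht : ∀ n i, (t n i : ℝ) = i * (s / (n + 1 : ℕ)) := fun n i => by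
    simp [t, hs]
  have htm : ∀ n, Monotone (t n) := fun n i j hij => by
    simp only [t]; gcongr
  let S : ℕ → Ω → ℝ := fun n ω => ∑ i ∈ Finset.range (n + 1),
    (-(σ * g (t n (i + 1)))) * (C (t n (i + 1)) ω - C (t n i) ω)
  have hg : ∀ u, HasDerivAt g (-Real.exp (-(a * (s - u)))) u := fun u => by
    have hE : HasDerivAt (fun u => Real.exp (-(a * (s - u)))) (Real.exp (-(a * (s - u))) * a) u := by
      simpa using (((hasDerivAt_id u).const_sub s).const_mul a).neg.exp
    refine ((hE.const_sub 1).div_const a).congr_deriv ?_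
    field_simp
  have hgc : Continuous g := by fun_prop
  have hlim : ∀ ω, Tendsto (fun n => ENNReal.ofReal (Real.exp (S n ω))) atTop
      (𝓝 (ENNReal.ofReal (Real.exp (-(σ * ∫ u in (0 : ℝ)..s,
        C u.toNNReal ω * Real.exp (-(a * (s - u)))))))) := by
    intro ω
    have hw : Continuous fun u : ℝ => C u.toNNReal ω := (hcont ω).comp continuous_real_toNNReal
    have key := tendsto_sum_mul_sub hw (by simp [hzero]) hg (by fun_prop) hs (by simp [g])
    refine (ENNReal.continuous_ofReal.tendsto _).comp ((Real.continuous_exp.tendsto _).comp ?_)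
    convert! (key.const_mul σ).neg using 1
    · funext n
      simp only [S]
      rw [Finset.mul_sum, ← Finset.sum_neg_distrib]
      refine Finset.sum_congr rfl fun i _ => ?_
      rw [← ht, ← ht, Real.toNNReal_coe, Real.toNNReal_coe]
      ring
    · simp [intervalIntegral.integral_neg]
  -- Monotonicity makes right endpoint sums lower sums, so the moment bound holds for every `n`
  -- without a limit of variances.
  have hanti : AntitoneOn (fun u => g u ^ 2) (Set.Icc 0 s) := by
    intro x hx y hy hxy
    have h1 : Real.exp (-(a * (s - x))) ≤ Real.exp (-(a * (s - y))) := by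
      gcongr
    have h2 : Real.exp (-(a * (s - y))) ≤ 1 := by
      rw [Real.exp_le_one_iff]
      nlinarith [hy.2]
    simp only [g]
    have h3 : 0 ≤ 1 - Real.exp (-(a * (s - y))) := by linarith
    gcongr
  have hbound : ∀ n, ∫⁻ ω, ENNReal.ofReal (Real.exp (S n ω)) ∂P
      ≤ ENNReal.ofReal (Real.exp (σ ^ 2 / (2 * a ^ 2) * (s - 2 * (1 - Real.exp (-(a * s))) / a
        + (1 - Real.exp (-(a * s)) ^ 2) / (2 * a)))) := by
    intro n
    rw [lintegral_exp_sum_increments hC (htm n)]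
    refine ENNReal.ofReal_le_ofReal (Real.exp_le_exp.2 ?_)
    have h1 := sum_mul_le_integral_of_antitoneOn (hgc.pow 2) hs hanti n
    have h2 : ∫ u in (0 : ℝ)..s, g u ^ 2 = (s - 2 * (1 - Real.exp (-(a * s))) / a
        + (1 - Real.exp (-(a * s)) ^ 2) / (2 * a)) / a ^ 2 := by
      rw [← integral_one_sub_exp_sq ha.ne', ← intervalIntegral.integral_div]
      simp only [g, div_pow]
    calc _ = σ ^ 2 / 2 * ∑ i ∈ Finset.range (n + 1),
          g ((i + 1 : ℕ) * (s / (n + 1 : ℕ))) ^ 2 * (s / (n + 1 : ℕ)) := by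
          rw [Finset.mul_sum]
          refine Finset.sum_congr rfl fun i _ => ?_
          rw [ht, ht]
          push_cast
          ring
      _ ≤ σ ^ 2 / 2 * ∫ u in (0 : ℝ)..s, g u ^ 2 :=
          mul_le_mul_of_nonneg_left h1 (by positivity)
      _ = _ := by rw [h2]; field_simp
  calc _ = ∫⁻ ω, liminf (fun n => ENNReal.ofReal (Real.exp (S n ω))) atTop ∂P :=
        lintegral_congr fun ω => (hlim ω).liminf_eq.symm
    _ ≤ liminf (fun n => ∫⁻ ω, ENNReal.ofReal (Real.exp (S n ω)) ∂P) atTop := by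
        refine lintegral_liminf_le' fun n => ?_
        have hm : ∀ u, AEMeasurable (C u) P := hC.aemeasurable
        fun_prop
    _ ≤ _ := liminf_le_of_le (by isBoundedDefault) fun b hb => by
        obtain ⟨n, hn⟩ := hb.exists
        exact hn.trans (hbound n)

/-! ### The expected discount factor -/

/-- A measurable Brownian motion is indistinguishable from a measurable one all of whose paths are
continuous and start at `0`. -/
theorem exists_continuous_version {Ω : Type*} [MeasurableSpace Ω] {P : Measure Ω}
    {B : ℝ≥0 → Ω → ℝ} (hB : IsBrownianReal B P) (hm : ∀ t, Measurable (B t)) :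
    ∃ C : ℝ≥0 → Ω → ℝ, (∀ t, Measurable (C t)) ∧ (∀ ω, Continuous fun t => C t ω) ∧
      (∀ ω, C 0 ω = 0) ∧ (∀ᵐ ω ∂P, ∀ t, B t ω = C t ω) ∧ IsPreBrownianReal C P := by
  classical
  have hae : ∀ᵐ ω ∂P, (Continuous fun t => B t ω) ∧ B 0 ω = 0 :=
    hB.cont.and hB.eval_zero_ae_eq_zero
  obtain ⟨A, hA, hAm, hAP⟩ := hae.exists_measurable_mem
  have hind : ∀ᵐ ω ∂P, ∀ t, B t ω = A.indicator (B t) ω := by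
    filter_upwards [hA] with ω hω t
    rw [Set.indicator_of_mem hω]
  refine ⟨fun t => A.indicator (B t), fun t => (hm t).indicator hAm, fun ω => ?_, fun ω => ?_, hind,
    hB.toIsPreBrownianReal.congr fun t => hind.mono fun ω h => h t⟩
  · by_cases hω : ω ∈ A
    · simpa [hω] using (hAP ω hω).1
    · simpa [hω] using continuous_const
  · by_cases hω : ω ∈ A
    · simpa [hω] using (hAP ω hω).2
    · simp [hω]

/-- The exponent of the mean discount factor is at most `-b s - min ((r - b) / a) 0`. -/
theorem discount_exponent_le {a β σ b r s : ℝ} (ha : 0 < a) (hb : b = β - σ ^ 2 / (2 * a ^ 2))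
    (hs : 0 ≤ s) :
    -(β * s + (r - β) * (1 - Real.exp (-(a * s))) / a)
      + σ ^ 2 / (2 * a ^ 2) * (s - 2 * (1 - Real.exp (-(a * s))) / a
        + (1 - Real.exp (-(a * s)) ^ 2) / (2 * a)) ≤ -b * s + -min ((r - b) / a) 0 := by
  have he0 : 0 < Real.exp (-(a * s)) := Real.exp_pos _
  have he1 : Real.exp (-(a * s)) ≤ 1 := by
    rw [Real.exp_le_one_iff]
    nlinarith
  generalize Real.exp (-(a * s)) = e at he0 he1 ⊢
  -- `1 - e` lies in `[0, 1]`.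
  have h1 : min ((r - b) / a) 0 ≤ (r - b) / a * (1 - e) := by
    rcases le_total 0 ((r - b) / a) with h | h
    · exact (min_le_right _ _).trans (mul_nonneg h (by linarith))
    · refine (min_le_left _ _).trans ?_
      nlinarith
  have h2 : -(β * s + (r - β) * (1 - e) / a)
      + σ ^ 2 / (2 * a ^ 2) * (s - 2 * (1 - e) / a + (1 - e ^ 2) / (2 * a))
      = -b * s - (r - b) / a * (1 - e) - σ ^ 2 / (4 * a ^ 3) * (1 - e) ^ 2 := by
    rw [hb]
    field_simp
    ring
  have h3 : 0 ≤ σ ^ 2 / (4 * a ^ 3) * (1 - e) ^ 2 := by positivity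
  rw [h2]
  linarith

theorem lintegral_exp_neg_mul_Ici {b : ℝ} (hb : 0 < b) :
    ∫⁻ s in Set.Ici (0 : ℝ), ENNReal.ofReal (Real.exp (-b * s)) = ENNReal.ofReal (1 / b) := by
  rw [setLIntegral_congr Ioi_ae_eq_Ici.symm, ← ofReal_integral_eq_lintegral_ofReal
    (integrableOn_exp_mul_Ioi (neg_lt_zero.2 hb) 0) (ae_of_all _ fun _ => (Real.exp_pos _).le),
    integral_exp_mul_Ioi (neg_lt_zero.2 hb)]
  simp

/-- The expected discounted value of paying dividends at unit rate forever. -/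
theorem lintegral_discount_le {Ω : Type*} [MeasurableSpace Ω] {P : Measure Ω}
    [IsProbabilityMeasure P] (m : Model Ω P) {b : ℝ}
    (hb : b = m.bhat - m.sigma ^ 2 / (2 * m.a ^ 2)) (hb_pos : 0 < b) (r : ℝ) :
    ∫⁻ ω, (∫⁻ s in Set.Ici (0 : ℝ), ENNReal.ofReal (Real.exp (-m.integratedRate r s ω))) ∂P
      ≤ ENNReal.ofReal (Real.exp (-min ((r - b) / m.a) 0) / b) := by
  obtain ⟨C, hCm, hCc, hC0, hBC, hC⟩ := exists_continuous_version m.brownian m.B_measurable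
  let μ : ℝ → ℝ := fun s => m.bhat * s + (r - m.bhat) * (1 - Real.exp (-(m.a * s))) / m.a
  let F : ℝ → Ω → ℝ := fun s ω =>
    ∫ u in (0 : ℝ)..s, C u.toNNReal ω * Real.exp (-(m.a * (s - u)))
  -- One null set serves all `s`, so `U` can be replaced by a jointly measurable expression before
  -- Tonelli; `rate` itself is not assumed measurable.
  have hrate : ∀ᵐ ω ∂P, ∀ s : ℝ, 0 ≤ s → m.integratedRate r s ω = μ s + m.sigma * F s ω := by
    filter_upwards [m.rate_sde r, hBC] with ω hω hB s hs
    refine integral_eq_of_vasicek m.a_pos.ne' (hω.1.comp continuous_real_toNNReal)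
      ((hCc ω).comp continuous_real_toNNReal) hs fun t ht => ?_
    have := hω.2 t.toNNReal
    rw [Real.coe_toNNReal t ht, hB] at this
    exact this
  have hCmeas : Measurable (Function.uncurry C) :=
    measurable_uncurry_of_continuous_of_measurable hCc hCm
  have hFmeas : Measurable (Function.uncurry F) := by
    refine measurable_uncurry_of_continuous_of_measurable (fun ω => ?_) fun s => ?_
    · have hw : Continuous fun u : ℝ => C u.toNNReal ω :=
        (hCc ω).comp continuous_real_toNNReal
      exact intervalIntegral.continuous_parametric_intervalIntegral_of_continuous
        (by fun_prop) continuous_id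
    · have h : Measurable (Function.uncurry fun (ω : Ω) (u : ℝ) =>
          C u.toNNReal ω * Real.exp (-(m.a * (s - u)))) := by
        have : Measurable fun p : Ω × ℝ => C p.2.toNNReal p.1 :=
          hCmeas.comp (f := fun p : Ω × ℝ => (p.2.toNNReal, p.1)) (by fun_prop)
        exact this.mul (by fun_prop)
      simp only [F, intervalIntegral]
      exact (h.stronglyMeasurable.integral_prod_right.sub
        h.stronglyMeasurable.integral_prod_right).measurable
  calc _ = ∫⁻ ω, (∫⁻ s in Set.Ici (0 : ℝ),
        ENNReal.ofReal (Real.exp (-(μ s + m.sigma * F s ω)))) ∂P := by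
        refine lintegral_congr_ae (hrate.mono fun ω hω => ?_)
        refine setLIntegral_congr_fun measurableSet_Ici fun s hs => ?_
        simp only [hω s hs]
    _ = ∫⁻ s in Set.Ici (0 : ℝ), (∫⁻ ω,
        ENNReal.ofReal (Real.exp (-(μ s + m.sigma * F s ω))) ∂P) := by
        refine lintegral_lintegral_swap (Measurable.aemeasurable ?_)
        have h1 : Measurable fun p : Ω × ℝ => F p.2 p.1 := hFmeas.comp measurable_swap
        have h2 : Measurable μ := by fun_prop
        simp only [Function.uncurry_def]
        fun_prop
    _ ≤ ∫⁻ s in Set.Ici (0 : ℝ), ENNReal.ofReal (Real.exp (-b * s))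
        * ENNReal.ofReal (Real.exp (-min ((r - b) / m.a) 0)) := by
        refine setLIntegral_mono' measurableSet_Ici fun s hs => ?_
        calc _ = ENNReal.ofReal (Real.exp (-μ s)) * ∫⁻ ω,
              ENNReal.ofReal (Real.exp (-(m.sigma * F s ω))) ∂P := by
              rw [← lintegral_const_mul' _ _ ENNReal.ofReal_ne_top]
              refine lintegral_congr fun ω => ?_
              rw [← ENNReal.ofReal_mul (Real.exp_pos _).le, ← Real.exp_add, neg_add]
          _ ≤ _ := by
              refine (mul_le_mul_right (lintegral_exp_neg_integral_le hC hCc hC0 m.a_pos m.sigma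
                hs) _).trans ?_
              rw [← ENNReal.ofReal_mul (Real.exp_pos _).le, ← Real.exp_add,
                ← ENNReal.ofReal_mul (Real.exp_pos _).le, ← Real.exp_add]
              exact ENNReal.ofReal_le_ofReal (Real.exp_le_exp.2
                (discount_exponent_le m.a_pos hb hs))
    _ = _ := by
        rw [lintegral_mul_const' _ _ ENNReal.ofReal_ne_top, lintegral_exp_neg_mul_Ici hb_pos,
          ← ENNReal.ofReal_mul (by positivity)]
        congr 1
        ring

end VasicekDividend

theorem lemma1 {Ω : Type*} [MeasurableSpace Ω] (P : Measure Ω) [IsProbabilityMeasure P]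
    (m : VasicekDividend.Model Ω P) (b : ℝ)
    (hb : b = m.bhat - m.sigma ^ 2 / (2 * m.a ^ 2)) (hb_pos : 0 < b)
    (r x : ℝ) (hx : 0 ≤ x) :
    m.value r x ≤ ENNReal.ofReal (m.M * Real.exp (-min ((r - b) / m.a) 0) / b) := by
  refine iSup₂_le fun l hl => ?_
  calc m.returnFunction l r x
      ≤ ∫⁻ ω, ENNReal.ofReal m.M * (∫⁻ s in Set.Ici (0 : ℝ),
          ENNReal.ofReal (Real.exp (-m.integratedRate r s ω))) ∂P := by
        refine lintegral_mono fun ω => ?_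
        rw [← lintegral_const_mul' _ _ ENNReal.ofReal_ne_top]
        -- Enlarging the horizon to `[0, ∞)` needs no measurability of the ruin time.
        refine (lintegral_mono_set fun s hs => hs.1).trans (lintegral_mono fun s => ?_)
        rw [← ENNReal.ofReal_mul m.M_pos.le, mul_comm m.M]
        exact ENNReal.ofReal_le_ofReal
          (mul_le_mul_of_nonneg_left (hl.mem_Icc _ _).2 (Real.exp_pos _).le)
    _ ≤ ENNReal.ofReal m.M * ENNReal.ofReal (Real.exp (-min ((r - b) / m.a) 0) / b) := by
        rw [lintegral_const_mul' _ _ ENNReal.ofReal_ne_top]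
        exact mul_le_mul_right (VasicekDividend.lintegral_discount_le m hb hb_pos r) _
    _ = _ := by
        rw [← ENNReal.ofReal_mul m.M_pos.le, mul_div_assoc]
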